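/- Let $d\ge 0$ be an integer and $\alpha\in(0,1/2)$, so that $1/\alpha>2$. A Lévy process $(Y(t),\,t\ge 0)$ in $\mathbb{R}^d$ is a process with stationary independent increments, starting at zero and with cadlag paths (the last two almost surely). For $0\le a\le b$, $h$ a continuous function of bounded variation on $[a,b]$ and $r$ a continuous increasing time change, the random integral is defined pathwise by formal integration by parts, $$\int_{(a,b]}h(s)\,dY(r(s)) := h(b)Y(r(b))-h(a)Y(r(a))-\int_{(a,b]}Y(r(s)-)\,dh(s).$$ For $\beta>0$ let $\mathcal{U}_\beta$, the class of generalized s-selfdecomposable distributions on $\mathbb{R}^d$, be the set of all laws of $\int_{(0,1]}s\,dY(s^\beta)$, where $Y$ is a Lévy process and the law of $Y(1)$ is any infinitely divisible probability measure on $\mathbb{R}^d$. Let $\nu$ be an infinitely divisible probability measure on $\mathbb{R}^d$ and $Y_\nu$ any Lévy process such that $Y_\nu(1)$ has law $\nu$. Then for every $t>0$ the law of $$V^{(\nu)}(t)=\int_{(0,t]}(t-s)^\alpha\,dY_\nu(s)$$ belongs to $\mathcal{U}_{1/\alpha}$. -/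

import Mathlib

open MeasureTheory ProbabilityTheory Filter Set Topology
open scoped NNReal

/-- The `n`-fold convolution power of a measure. -/
noncomputable def convPower {E : Type*} [AddMonoid E] [MeasurableSpace E]
    (ρ : Measure E) : ℕ → Measure E
  | 0 => Measure.dirac 0
  | n + 1 => convPower ρ n ∗ ρ

/-- The class `ID`: `μ` is a probability measure which has, for every `n ≥ 1`, a convolution
root of order `n` among the probability measures. -/
def IsInfinitelyDivisible {E : Type*} [AddMonoid E] [MeasurableSpace E] (μ : Measure E) : Prop :=
  IsProbabilityMeasure μ ∧
    ∀ n : ℕ, 1 ≤ n → ∃ ρ : Measure E, IsProbabilityMeasure ρ ∧ convPower ρ n = μ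

/-- A path on `[0, ∞)` that is continuous from the right and has finite left limits. -/
def IsCadlag {E : Type*} [TopologicalSpace E] (x : ℝ≥0 → E) : Prop :=
  ∀ t : ℝ≥0, ContinuousWithinAt x (Ici t) t ∧ ∃ l : E, Tendsto x (𝓝[<] t) (𝓝 l)

/-- A Lévy process `(Y t, t ≥ 0)`: stationary independent increments, start at zero, and
cadlag paths (the last two almost surely). -/
structure IsLevyProcess {Ω E : Type*} [MeasurableSpace Ω] [NormedAddCommGroup E]
    [MeasurableSpace E] (Y : ℝ≥0 → Ω → E) (P : Measure Ω) : Prop where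
  isProbabilityMeasure : IsProbabilityMeasure P
  measurable : ∀ t, Measurable (Y t)
  indep_increments : HasIndepIncrements Y P
  stationary_increments : ∀ s u : ℝ≥0,
    IdentDistrib (fun ω => Y (s + u) ω - Y s ω) (fun ω => Y u ω - Y 0 ω) P P
  start_zero : ∀ᵐ ω ∂P, Y 0 ω = 0
  cadlag : ∀ᵐ ω ∂P, IsCadlag (fun t => Y t ω)

/-- A function of bounded variation on `[a, b]`, extended by constants to the left of `a` and
to the right of `b`, has bounded variation on the line. -/
theorem boundedVariationOn_clamp {h : ℝ → ℝ} {a b : ℝ} (hab : a ≤ b)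
    (hh : BoundedVariationOn h (Icc a b)) :
    BoundedVariationOn (fun s => h (max a (min b s))) univ := by
  refine ne_top_of_le_ne_top hh
    (eVariationOn.comp_le_of_monotoneOn h (fun s => max a (min b s)) ?_ ?_)
  · intro x _ y _ hxy
    exact max_le_max le_rfl (min_le_min le_rfl hxy)
  · intro x _
    exact ⟨le_max_left _ _, max_le hab (min_le_left _ _)⟩

/-- The (signed) Lebesgue-Stieltjes measure `dh` of a function `h` of bounded variation on
`[a, b]`; it is used on `(a, b]` only. -/
noncomputable def stieltjesMeasure {h : ℝ → ℝ} {a b : ℝ} (hab : a ≤ b)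
    (hh : BoundedVariationOn h (Icc a b)) : SignedMeasure ℝ :=
  (boundedVariationOn_clamp hab hh).vectorMeasure

/-- The random integral `∫_{(a,b]} h(s) dY(r(s))`, for `h` (right-)continuous of bounded variation
on `[a, b]` and a time change `r`. It is defined pathwise, by formal integration by parts:
`h(b) Y(r(b)) - h(a) Y(r(a)) - ∫_{(a,b]} Y(r(s)-) dh(s)`. -/
noncomputable def randomIntegral {Ω E : Type*} [NormedAddCommGroup E] [NormedSpace ℝ E]
    (Y : ℝ≥0 → Ω → E) (r : ℝ → ℝ≥0) {h : ℝ → ℝ} {a b : ℝ} (hab : a ≤ b)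
    (hh : BoundedVariationOn h (Icc a b)) (ω : Ω) : E :=
  h b • Y (r b) ω - h a • Y (r a) ω
    - ∫ᵛ s in Ioc a b, Function.leftLim (fun u => Y (r u) ω) s ∂<•(stieltjesMeasure hab hh)

theorem boundedVariationOn_id_unit : BoundedVariationOn (fun s : ℝ => s) (Icc 0 1) := by
  have h : MonotoneOn (fun s : ℝ => s) (Icc 0 1) := monotone_id.monotoneOn _
  have := h.locallyBoundedVariationOn 0 1 (by simp) (by simp)
  rwa [inter_self] at this

theorem boundedVariationOn_rpow_sub {α t : ℝ} (hα : 0 < α) (ht : 0 < t) :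
    BoundedVariationOn (fun s : ℝ => (t - s) ^ α) (Icc 0 t) := by
  have h : MonotoneOn (fun s : ℝ => -(t - s) ^ α) (Icc 0 t) := by
    intro x _ y hy hxy
    exact neg_le_neg (Real.rpow_le_rpow (sub_nonneg.2 hy.2) (by linarith) hα.le)
  have h1 := h.locallyBoundedVariationOn 0 t ⟨le_rfl, ht.le⟩ ⟨ht.le, le_rfl⟩
  rw [inter_self] at h1
  have h2 := (LipschitzWith.id (α := ℝ)).neg.comp_boundedVariationOn h1
  simpa [Function.comp_def] using h2

/-- `μ = 𝒥^β(ν)`, i.e. `μ` is the law of `∫_{(0,1]} s dY(s^β)` for a Lévy process `Y` such that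
`Y(1)` has the law `ν` (here `β > 0`). -/
def IsJurekImage {E : Type*} [NormedAddCommGroup E] [NormedSpace ℝ E] [MeasurableSpace E]
    (β : ℝ) (ν μ : Measure E) : Prop :=
  ∃ (Ω : Type) (_ : MeasurableSpace Ω) (P : Measure Ω) (Y : ℝ≥0 → Ω → E),
    IsLevyProcess Y P ∧ HasLaw (Y 1) ν P ∧
      HasLaw (randomIntegral Y (fun s => Real.toNNReal (s ^ β)) (zero_le_one' ℝ)
        boundedVariationOn_id_unit) μ P

/-- The class `𝒰_β = 𝒥^β(ID)`, `β > 0`, of generalized s-selfdecomposable distributions. -/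
def GenSSelfdecomposable (E : Type*) [NormedAddCommGroup E] [NormedSpace ℝ E]
    [MeasurableSpace E] (β : ℝ) : Set (Measure E) :=
  {μ | ∃ ν : Measure E, IsInfinitelyDivisible ν ∧ IsJurekImage β ν μ}

/-- `V(t) = ∫_{(0,t]} (t - s)^α dY(s)`. -/
noncomputable def fractionalV {Ω E : Type*} [NormedAddCommGroup E] [NormedSpace ℝ E]
    (Y : ℝ≥0 → Ω → E) {α t : ℝ} (hα : 0 < α) (ht : 0 < t) : Ω → E :=
  randomIntegral Y Real.toNNReal ht.le (boundedVariationOn_rpow_sub hα ht)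

/-! ### Pathwise convergence of Riemann sums to the random integral -/

section Pathwise

/-! Reversing time on `[0, t]` preserves the law of the increments, so `∫ (t - s)^α dY(s)` should
have the law of `∫ s^α dY(s)`. With `Z(v) = t^α Y(tv)` and a change of clock this is `∫_{(0,1]} s
dZ(s^{1/α})`. Since `Z` is again a Lévy process, `Z(1)` is infinitely divisible and the law lies in
the class.

The reversal is carried out on characteristic functions, not on paths. Both integrals are pathwise
limits of Riemann sums (`tendsto_riemannSum_randomIntegral`) over partitions equidistant in the
clock of the process. By `IsLevyProcess.charFun_map_sum` the characteristic function of such a sum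
is a product of factors `f j`, the characteristic function of `Y(t/n)` at `(tj/n)^α ξ`. For `V` the
index `j` runs over `0, ..., n - 1`, for the other integral over `1, ..., n`. As `f 0 = 1`, and `f n
→ 1` by right-continuity of `Y` at zero, the limits agree. -/

instance isFiniteMeasure_variation_signedMeasure {X : Type*} [MeasurableSpace X]
    (μ : SignedMeasure X) : IsFiniteMeasure (VectorMeasure.variation μ) := by
  rw [← SignedMeasure.totalVariation_eq_variation]
  infer_instance

theorem IsCadlag.isBounded_image {E : Type*} [PseudoMetricSpace E] {x : ℝ≥0 → E}
    (hx : IsCadlag x) {K : Set ℝ≥0} (hK : IsCompact K) : Bornology.IsBounded (x '' K) := by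
  refine hK.induction_on (p := fun s => Bornology.IsBounded (x '' s)) (by simp)
    (fun s t hst ht => ht.subset (image_mono hst))
    (fun s t hs ht => by rw [image_union]; exact hs.union ht) fun t _ => ?_
  obtain ⟨hr, l, hl⟩ := hx t
  -- The one-sided limits bound the path near `t`: close to `l` on the left, close to `x t` on the
  -- right.
  refine ⟨x ⁻¹' (Metric.ball l 1) ∪ x ⁻¹' (Metric.ball (x t) 1), mem_nhdsWithin_of_mem_nhds ?_, ?_⟩
  · rw [← nhdsLT_sup_nhdsGE]
    exact ⟨mem_of_superset (hl (Metric.ball_mem_nhds l one_pos)) subset_union_left,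
      mem_of_superset (hr (Metric.ball_mem_nhds _ one_pos)) subset_union_right⟩
  · rw [image_union]
    exact (Metric.isBounded_ball.subset (image_preimage_subset _ _)).union
      (Metric.isBounded_ball.subset (image_preimage_subset _ _))

theorem stieltjesMeasure_Ioc {h : ℝ → ℝ} {a b : ℝ} (hab : a ≤ b)
    (hh : BoundedVariationOn h (Icc a b)) (hc : ContinuousOn h (Icc a b)) {u v : ℝ}
    (hau : a ≤ u) (huv : u ≤ v) (hvb : v ≤ b) :
    stieltjesMeasure hab hh (Ioc u v) = h v - h u := by
  have hcont : Continuous fun s => h (max a (min b s)) :=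
    hc.comp_continuous (by fun_prop) fun s => ⟨le_max_left _ _, max_le hab (min_le_left _ _)⟩
  have key (s : ℝ) (h1 : a ≤ s) (h2 : s ≤ b) :
      Function.rightLim (fun s => h (max a (min b s))) s = h s := by
    rw [hcont.continuousAt.continuousWithinAt.rightLim_eq, min_eq_right h2, max_eq_right h1]
  rw [stieltjesMeasure, BoundedVariationOn.vectorMeasure_Ioc _ huv, key v (by linarith) hvb,
    key u hau (by linarith)]

/-- Abel summation undoes the formal integration by parts: sampling `z` at left end points against
`dh` leaves a Riemann sum with `h` at right end points. -/
theorem summation_by_parts {E : Type*} [AddCommGroup E] [Module ℝ E] (h : ℕ → ℝ) (z : ℕ → E)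
    (n : ℕ) :
    h n • z n - h 0 • z 0 - ∑ k ∈ Finset.range n, (h (k + 1) - h k) • z k =
      ∑ k ∈ Finset.range n, h (k + 1) • (z (k + 1) - z k) := by
  induction n with
  | zero => simp
  | succ n ih =>
    rw [Finset.sum_range_succ, Finset.sum_range_succ, ← ih]
    module

variable {E : Type*} [NormedAddCommGroup E]

/-- The step function that takes the value of `z` at the lower end point on each of the intervals
`(g (k / n), g ((k + 1) / n)]`. -/
noncomputable def lowerStep (g : ℝ → ℝ) (z : ℝ → E) (n : ℕ) (s : ℝ) : E :=
  ∑ k ∈ Finset.range n, (Ioc (g (k / n)) (g ((k + 1 : ℕ) / n))).indicator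
    (fun _ => z (g (k / n))) s

theorem div_mem_unitInterval {k n : ℕ} (hk : k ≤ n) : (k / n : ℝ) ∈ Icc (0 : ℝ) 1 :=
  ⟨by positivity, div_le_one_of_le₀ (by exact_mod_cast hk) (by positivity)⟩

/-- The lower end point of the interval `(k / n, (k + 1) / n]` that contains `v`. -/
noncomputable def lowerPoint (v : ℝ) (n : ℕ) : ℝ := ((⌈v * n⌉₊ - 1 : ℕ) : ℝ) / n

theorem natCeil_pred_mem {v : ℝ} (hv : v ∈ Ioc (0 : ℝ) 1) {n : ℕ} (hn : 0 < n) :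
    ⌈v * n⌉₊ - 1 < n ∧ ((⌈v * n⌉₊ - 1 : ℕ) : ℝ) < v * n ∧
      v * n ≤ ((⌈v * n⌉₊ - 1 + 1 : ℕ) : ℝ) := by
  have hn' : (0 : ℝ) < n := by exact_mod_cast hn
  have hpos : 0 < ⌈v * n⌉₊ := Nat.ceil_pos.2 (mul_pos hv.1 hn')
  have hle : ⌈v * n⌉₊ ≤ n := Nat.ceil_le.2 (by nlinarith [hv.2])
  refine ⟨by omega, Nat.lt_ceil.1 (by omega), ?_⟩
  rw [Nat.sub_add_cancel hpos]
  exact Nat.le_ceil _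

theorem lowerStep_apply {g : ℝ → ℝ} (hg : StrictMonoOn g (Icc 0 1)) (z : ℝ → E) {v : ℝ}
    (hv : v ∈ Ioc (0 : ℝ) 1) {n : ℕ} (hn : 0 < n) :
    lowerStep g z n (g v) = z (g (lowerPoint v n)) := by
  have hn' : (0 : ℝ) < n := by exact_mod_cast hn
  have hv' : v ∈ Icc (0 : ℝ) 1 := Ioc_subset_Icc_self hv
  obtain ⟨h1, h2, h3⟩ := natCeil_pred_mem hv hn
  rw [lowerStep, Finset.sum_eq_single_of_mem _ (Finset.mem_range.2 h1), indicator_of_mem]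
  · rfl
  · exact ⟨hg (div_mem_unitInterval h1.le) hv' ((div_lt_iff₀ hn').2 h2),
      hg.monotoneOn hv' (div_mem_unitInterval h1) ((le_div_iff₀ hn').2 h3)⟩
  · intro k hk hne
    have hk' := Finset.mem_range.1 hk
    refine indicator_of_notMem (fun hmem => hne ?_) _
    have h4 := (hg.lt_iff_lt (div_mem_unitInterval hk'.le) hv').1 hmem.1
    have h5 := (hg.le_iff_le hv' (div_mem_unitInterval hk')).1 hmem.2
    rw [div_lt_iff₀ hn'] at h4
    rw [le_div_iff₀ hn'] at h5
    have h6 : k < ⌈v * n⌉₊ := Nat.lt_ceil.2 h4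
    have h7 : ⌈v * n⌉₊ ≤ k + 1 := Nat.ceil_le.2 h5
    omega

/-- The approach is strictly from the left, so that sampling a path there picks up its left limit
and never its value at a jump. -/
theorem tendsto_lowerPoint {v : ℝ} (hv : v ∈ Ioc (0 : ℝ) 1) :
    Tendsto (lowerPoint v) atTop (𝓝[Ico 0 v] v) := by
  refine tendsto_nhdsWithin_iff.2 ⟨?_, ?_⟩
  · have h1 : Tendsto (fun n : ℕ => v - 1 / (n : ℝ)) atTop (𝓝 v) := by
      simpa using tendsto_const_nhds.sub (tendsto_one_div_atTop_nhds_zero_nat (𝕜 := ℝ))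
    refine tendsto_of_tendsto_of_tendsto_of_le_of_le' h1 tendsto_const_nhds ?_ ?_
    · filter_upwards [eventually_gt_atTop 0] with n hn
      have hn' : (0 : ℝ) < n := by exact_mod_cast hn
      obtain ⟨-, h2, h3⟩ := natCeil_pred_mem hv hn
      push_cast at h3
      rw [lowerPoint, le_div_iff₀ hn', sub_mul, one_div_mul_cancel hn'.ne']
      linarith
    · filter_upwards [eventually_gt_atTop 0] with n hn
      have hn' : (0 : ℝ) < n := by exact_mod_cast hn
      rw [lowerPoint, div_le_iff₀ hn']
      exact (natCeil_pred_mem hv hn).2.1.le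
  · filter_upwards [eventually_gt_atTop 0] with n hn
    have hn' : (0 : ℝ) < n := by exact_mod_cast hn
    refine ⟨by rw [lowerPoint]; positivity, ?_⟩
    rw [lowerPoint, div_lt_iff₀ hn']
    exact (natCeil_pred_mem hv hn).2.1

variable [NormedSpace ℝ E]

theorem integral_lowerStep [CompleteSpace E] {h g : ℝ → ℝ} {a b : ℝ} (hab : a ≤ b)
    (hh : BoundedVariationOn h (Icc a b)) (hc : ContinuousOn h (Icc a b))
    (hg : StrictMonoOn g (Icc 0 1)) (hg0 : g 0 = a) (hg1 : g 1 = b) (z : ℝ → E) (n : ℕ) :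
    ∫ᵛ s in Ioc a b, lowerStep g z n s ∂<•(stieltjesMeasure hab hh) =
      ∑ k ∈ Finset.range n, (h (g ((k + 1 : ℕ) / n)) - h (g (k / n))) • z (g (k / n)) := by
  simp only [lowerStep]
  rw [VectorMeasure.integral_finsetSum]
  · refine Finset.sum_congr rfl fun k hk => ?_
    have hk' := Finset.mem_range.1 hk
    have h0 : (0 : ℝ) ∈ Icc (0 : ℝ) 1 := ⟨le_rfl, zero_le_one⟩
    have h1 : (1 : ℝ) ∈ Icc (0 : ℝ) 1 := ⟨zero_le_one, le_rfl⟩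
    have hk1 := div_mem_unitInterval hk'.le
    have hk2 := div_mem_unitInterval (k := k + 1) hk'
    have ha : a ≤ g (k / n) := hg0 ▸ hg.monotoneOn h0 hk1 hk1.1
    have hb : g ((k + 1 : ℕ) / n) ≤ b := hg1 ▸ hg.monotoneOn hk2 h1 hk2.2
    have hm : g (k / n) ≤ g ((k + 1 : ℕ) / n) :=
      hg.monotoneOn hk1 hk2 (by gcongr; omega)
    rw [VectorMeasure.integral_indicator_const _ measurableSet_Ioc,
      VectorMeasure.restrict_apply _ measurableSet_Ioc measurableSet_Ioc,
      inter_eq_left.2 (Ioc_subset_Ioc ha hb), stieltjesMeasure_Ioc hab hh hc ha hm hb]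
    rfl
  · intro k _
    exact (integrable_const _).indicator measurableSet_Ioc

/-- Dominated convergence for the finite variation measure of `dh`: a bound for `z` dominates, and
the sampled values converge pointwise to the left limits. -/
theorem tendsto_integral_lowerStep {h g : ℝ → ℝ} {a b : ℝ} (hab : a ≤ b)
    (hh : BoundedVariationOn h (Icc a b))
    (hg : StrictMonoOn g (Icc 0 1)) (hgc : ContinuousOn g (Icc 0 1)) (hg0 : g 0 = a)
    (hg1 : g 1 = b) {z : ℝ → E} (hz : Bornology.IsBounded (z '' Icc a b))
    (hl : ∀ s ∈ Ioc a b, ∃ l, Tendsto z (𝓝[<] s) (𝓝 l)) :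
    Tendsto (fun n => ∫ᵛ s in Ioc a b, lowerStep g z n s ∂<•(stieltjesMeasure hab hh)) atTop
      (𝓝 (∫ᵛ s in Ioc a b, Function.leftLim z s ∂<•(stieltjesMeasure hab hh))) := by
  obtain ⟨C, hC⟩ := hz.exists_norm_le
  have h0 : (0 : ℝ) ∈ Icc (0 : ℝ) 1 := ⟨le_rfl, zero_le_one⟩
  have hsurj : ∀ s ∈ Ioc a b, ∃ v ∈ Ioc (0 : ℝ) 1, g v = s := by
    intro s hs
    obtain ⟨v, hv, rfl⟩ := intermediate_value_Icc zero_le_one hgc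
      (show s ∈ Icc (g 0) (g 1) from hg0 ▸ hg1 ▸ Ioc_subset_Icc_self hs)
    refine ⟨v, ⟨lt_of_le_of_ne hv.1 ?_, hv.2⟩, rfl⟩
    rintro rfl
    exact absurd hs.1 (by simp [hg0])
  have hae : ∀ᵐ s ∂(VectorMeasure.variation ((stieltjesMeasure hab hh).restrict (Ioc a b))),
      s ∈ Ioc a b := by
    rw [VectorMeasure.variation_restrict measurableSet_Ioc]
    exact ae_restrict_mem measurableSet_Ioc
  have hmem (v : ℝ) (hv : v ∈ Ioc (0 : ℝ) 1) {w : ℝ} (hw : w ∈ Ico 0 v) : g w ∈ Ico a (g v) := by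
    have hw' : w ∈ Icc (0 : ℝ) 1 := ⟨hw.1, hw.2.le.trans hv.2⟩
    exact ⟨hg0 ▸ hg.monotoneOn h0 hw' hw.1, hg hw' (Ioc_subset_Icc_self hv) hw.2⟩
  refine VectorMeasure.tendsto_integral_of_dominated_convergence (fun _ => max C 0) (fun n => ?_)
    (integrable_const _) (fun n => ?_) ?_
  · refine Finset.aestronglyMeasurable_fun_sum _ fun k _ => ?_
    exact aestronglyMeasurable_const.indicator measurableSet_Ioc
  · filter_upwards [hae] with s hs
    rcases Nat.eq_zero_or_pos n with rfl | hn
    · simp [lowerStep]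
    · obtain ⟨v, hv, rfl⟩ := hsurj s hs
      rw [lowerStep_apply hg z hv hn]
      refine (hC _ (mem_image_of_mem z ?_)).trans (le_max_left _ _)
      have hn' : (0 : ℝ) < n := by exact_mod_cast hn
      have := hmem v hv (w := lowerPoint v n) ⟨by rw [lowerPoint]; positivity, by
        rw [lowerPoint, div_lt_iff₀ hn']; exact (natCeil_pred_mem hv hn).2.1⟩
      exact ⟨this.1, this.2.le.trans hs.2⟩
  · filter_upwards [hae] with s hs
    obtain ⟨v, hv, rfl⟩ := hsurj s hs
    have hv' := Ioc_subset_Icc_self hv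
    have hcv : Tendsto g (𝓝[Ico 0 v] v) (𝓝[<] (g v)) := by
      refine tendsto_nhdsWithin_iff.2 ⟨((hgc v hv').mono ?_), ?_⟩
      · exact fun w hw => ⟨hw.1, hw.2.le.trans hv.2⟩
      · filter_upwards [self_mem_nhdsWithin] with w hw using (hmem v hv hw).2
    refine ((tendsto_leftLim_of_tendsto (hl _ hs)).comp
      (hcv.comp (tendsto_lowerPoint hv))).congr' ?_
    filter_upwards [eventually_gt_atTop 0] with n hn
    rw [lowerStep_apply hg z hv hn]
    rfl

/-- The random integral is the pathwise limit of its Riemann sums. -/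
theorem tendsto_riemannSum_randomIntegral [CompleteSpace E] {Ω : Type*} {Y : ℝ≥0 → Ω → E} {ω : Ω}
    (hY : IsCadlag fun s => Y s ω) {h g : ℝ → ℝ} {r : ℝ → ℝ≥0} {a b : ℝ} (hab : a ≤ b)
    (hh : BoundedVariationOn h (Icc a b)) (hc : ContinuousOn h (Icc a b))
    (hr : StrictMonoOn r (Icc a b)) (hrc : ContinuousOn r (Icc a b))
    (hg : StrictMonoOn g (Icc 0 1)) (hgc : ContinuousOn g (Icc 0 1)) (hg0 : g 0 = a)
    (hg1 : g 1 = b) :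
    Tendsto (fun n : ℕ => ∑ k ∈ Finset.range n, h (g ((k + 1 : ℕ) / n)) •
      (Y (r (g ((k + 1 : ℕ) / n))) ω - Y (r (g (k / n))) ω)) atTop
      (𝓝 (randomIntegral Y r hab hh ω)) := by
  have hz : Bornology.IsBounded ((fun u => Y (r u) ω) '' Icc a b) := by
    have := hY.isBounded_image (isCompact_Icc.image_of_continuousOn hrc)
    rwa [image_image] at this
  have hl : ∀ s ∈ Ioc a b, ∃ l, Tendsto (fun u => Y (r u) ω) (𝓝[<] s) (𝓝 l) := by
    intro s hs
    obtain ⟨l, hl⟩ := (hY (r s)).2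
    refine ⟨l, hl.comp ?_⟩
    -- Strict monotonicity of `r` keeps `r u < r s`, so the left limit of the path at `r s` applies.
    rw [← nhdsWithin_Ioo_eq_nhdsLT hs.1]
    have hsub : Ioo a s ⊆ Icc a b := fun u hu => ⟨hu.1.le, hu.2.le.trans hs.2⟩
    refine tendsto_nhdsWithin_iff.2 ⟨(hrc s (Ioc_subset_Icc_self hs)).mono hsub, ?_⟩
    filter_upwards [self_mem_nhdsWithin] with u hu
    exact hr (hsub hu) (Ioc_subset_Icc_self hs) hu.2
  have key := (tendsto_integral_lowerStep hab hh hg hgc hg0 hg1 hz hl).const_sub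
    (h b • Y (r b) ω - h a • Y (r a) ω)
  refine Tendsto.congr' ?_ key
  filter_upwards [eventually_gt_atTop 0] with n hn
  have hn' : (n : ℝ) ≠ 0 := by exact_mod_cast hn.ne'
  have := summation_by_parts (fun k : ℕ => h (g (k / n))) (fun k : ℕ => Y (r (g (k / n))) ω) n
  simp only [div_self hn', Nat.cast_zero, zero_div, hg0, hg1] at this
  rw [integral_lowerStep hab hh hc hg hg0 hg1, this]

end Pathwise

/-! ### Transformations of Lévy processes -/

section Levy

variable {Ω Ω' E : Type*} [MeasurableSpace Ω] [MeasurableSpace Ω'] [NormedAddCommGroup E]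

theorem IsCadlag.comp_mul {x : ℝ≥0 → E} (hx : IsCadlag x) {u : ℝ≥0} (hu : 0 < u) :
    IsCadlag fun s => x (u * s) := by
  intro s
  have hc : Tendsto (fun v : ℝ≥0 => u * v) (𝓝 s) (𝓝 (u * s)) := by
    exact (continuous_const_mul u).tendsto s
  obtain ⟨hr, l, hl⟩ := hx (u * s)
  refine ⟨hr.tendsto.comp (tendsto_nhdsWithin_iff.2 ⟨hc.mono_left nhdsWithin_le_nhds, ?_⟩),
    l, hl.comp (tendsto_nhdsWithin_iff.2 ⟨hc.mono_left nhdsWithin_le_nhds, ?_⟩)⟩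
  · filter_upwards [self_mem_nhdsWithin] with v hv using mul_le_mul_right hv u
  · filter_upwards [self_mem_nhdsWithin] with v hv using mul_lt_mul_of_pos_left hv hu

theorem IsCadlag.const_smul [NormedSpace ℝ E] {x : ℝ≥0 → E} (hx : IsCadlag x) (c : ℝ) :
    IsCadlag fun s => c • x s := fun s =>
  ⟨(hx s).1.const_smul c, let ⟨l, hl⟩ := (hx s).2; ⟨c • l, hl.const_smul c⟩⟩

variable [MeasurableSpace E] [BorelSpace E] {P : Measure Ω} {Y : ℝ≥0 → Ω → E}

theorem IsLevyProcess.smul_comp_mul [NormedSpace ℝ E] (hY : IsLevyProcess Y P) (c : ℝ) {u : ℝ≥0}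
    (hu : 0 < u) : IsLevyProcess (fun s ω => c • Y (u * s) ω) P where
  isProbabilityMeasure := hY.isProbabilityMeasure
  measurable s := (hY.measurable _).const_smul c
  indep_increments := by
    refine HasIndepIncrements.smul (X := fun s ω => Y (u * s) ω) (fun n t ht => ?_) c
    exact hY.indep_increments n (fun i => u * t i) fun i j hij => mul_le_mul_right (ht hij) u
  stationary_increments s v := by
    have := (hY.stationary_increments (u * s) (u * v)).comp (measurable_const_smul c)
    convert this using 1
    · ext ω; simp [mul_add, smul_sub]
    · ext ω; simp [smul_sub]
  start_zero := by
    filter_upwards [hY.start_zero] with ω hω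
    simp [hω]
  cadlag := by
    filter_upwards [hY.cadlag] with ω hω using (hω.comp_mul hu).const_smul c

variable [SecondCountableTopology E]

theorem IsLevyProcess.of_ae_eq (hY : IsLevyProcess Y P) {Z : ℝ≥0 → Ω → E}
    (hZ : ∀ s, Measurable (Z s)) (hYZ : ∀ᵐ ω ∂P, ∀ s, Y s ω = Z s ω) : IsLevyProcess Z P where
  isProbabilityMeasure := hY.isProbabilityMeasure
  measurable := hZ
  indep_increments n t ht := (hY.indep_increments n t ht).congr fun i => by
    filter_upwards [hYZ] with ω hω
    simp [hω]
  stationary_increments s u := by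
    refine (IdentDistrib.of_ae_eq ?_ ?_).trans ((hY.stationary_increments s u).trans
      (IdentDistrib.of_ae_eq ?_ ?_))
    · exact ((hZ _).sub (hZ _)).aemeasurable
    · filter_upwards [hYZ] with ω hω
      simp [hω]
    · exact ((hY.measurable _).sub (hY.measurable _)).aemeasurable
    · filter_upwards [hYZ] with ω hω
      simp [hω]
  start_zero := by
    filter_upwards [hYZ, hY.start_zero] with ω h1 h2
    rw [← h1, h2]
  cadlag := by
    filter_upwards [hYZ, hY.cadlag] with ω h1 h2
    simpa only [h1] using h2

/-- Apart from path regularity, being a Lévy process depends only on joint laws, which pass to the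
image measure. -/
theorem IsLevyProcess.of_comp {Φ : Ω → Ω'} (hΦ : Measurable Φ) {X : ℝ≥0 → Ω' → E}
    (hX : ∀ s, Measurable (X s)) (hXc : ∀ ω, IsCadlag fun s => X s ω)
    (h : IsLevyProcess (fun s ω => X s (Φ ω)) P) : IsLevyProcess X (P.map Φ) := by
  have := h.isProbabilityMeasure
  have hP : IsProbabilityMeasure (P.map Φ) := Measure.isProbabilityMeasure_map hΦ.aemeasurable
  have hmap {f : Ω' → E} (hf : Measurable f) : (P.map Φ).map f = P.map (fun ω => f (Φ ω)) :=
    Measure.map_map hf hΦ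
  refine ⟨hP, hX, fun n t ht => ?_, fun s u => ?_, ?_, ae_of_all _ hXc⟩
  · have hm (i : Fin n) : Measurable fun ω => X (t i.succ) ω - X (t i.castSucc) ω :=
      (hX _).sub (hX _)
    have key := h.indep_increments n t ht
    have hm' (i : Fin n) : Measurable fun ω => X (t i.succ) (Φ ω) - X (t i.castSucc) (Φ ω) :=
      (hm i).comp hΦ
    rw [iIndepFun_iff_map_fun_eq_pi_map fun i => (hm' i).aemeasurable] at key
    rw [iIndepFun_iff_map_fun_eq_pi_map fun i => (hm i).aemeasurable,
      Measure.map_map (measurable_pi_lambda _ hm) hΦ]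
    simp only [hmap (hm _)]
    exact key
  · refine ⟨((hX _).sub (hX _)).aemeasurable, ((hX _).sub (hX _)).aemeasurable, ?_⟩
    have hm (v w : ℝ≥0) : Measurable fun ω => X v ω - X w ω := (hX v).sub (hX w)
    rw [hmap (hm _ _), hmap (hm _ _)]
    exact (h.stationary_increments s u).map_eq
  · rw [ae_map_iff (p := fun ω => X 0 ω = 0) hΦ.aemeasurable (hX 0 (measurableSet_singleton 0))]
    exact h.start_zero

/-- Every Lévy process has a version on the space of cadlag paths. -/
theorem IsLevyProcess.exists_map_path (hY : IsLevyProcess Y P) :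
    ∃ Φ : Ω → {x : ℝ≥0 → E // IsCadlag x}, Measurable Φ ∧ (∀ᵐ ω ∂P, ∀ s, Y s ω = (Φ ω).1 s) ∧
      IsLevyProcess (fun s x => x.1 s) (P.map Φ) := by
  classical
  obtain ⟨N, hN, hNm, hN0⟩ := exists_measurable_superset_of_null (ae_iff.1 hY.cadlag)
  have h0 : IsCadlag fun _ : ℝ≥0 => (0 : E) := fun _ =>
    ⟨continuousWithinAt_const, 0, tendsto_const_nhds⟩
  -- Paths in the exceptional null set are replaced by the zero path.
  have hc (ω : Ω) : IsCadlag fun s => if ω ∈ N then 0 else Y s ω := by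
    by_cases hω : ω ∈ N
    · simpa [hω] using h0
    · simpa [hω] using by_contra fun h => hω (hN h)
  have hm (s : ℝ≥0) : Measurable fun ω => if ω ∈ N then 0 else Y s ω :=
    Measurable.ite hNm measurable_const (hY.measurable s)
  have hΦ : Measurable fun ω => (⟨fun s => if ω ∈ N then 0 else Y s ω, hc ω⟩ :
      {x : ℝ≥0 → E // IsCadlag x}) :=
    (measurable_pi_lambda _ hm).subtype_mk
  have hae : ∀ᵐ ω ∂P, ∀ s, Y s ω = if ω ∈ N then 0 else Y s ω := by
    filter_upwards [measure_eq_zero_iff_ae_notMem.1 hN0] with ω hω s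
    simp [hω]
  exact ⟨_, hΦ, hae, IsLevyProcess.of_comp hΦ
    (fun s => (measurable_pi_apply s).comp measurable_subtype_coe) (fun x => x.2)
    (hY.of_ae_eq hm hae)⟩

theorem IsLevyProcess.convPower_map (hY : IsLevyProcess Y P) (v : ℝ≥0) (n : ℕ) :
    convPower (P.map (Y v)) n = P.map (Y (n * v)) := by
  have := hY.isProbabilityMeasure
  induction n with
  | zero =>
    have : Y (((0 : ℕ) : ℝ≥0) * v) =ᵐ[P] fun _ => 0 := by
      filter_upwards [hY.start_zero] with ω hω
      simpa using hω
    rw [Measure.map_congr this, Measure.map_const, convPower]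
    simp
  | succ n ih =>
    have hle : (n : ℝ≥0) * v ≤ n * v + v := le_self_add
    have hind := hY.indep_increments.indepFun_eval_sub zero_le hle hY.start_zero
    have hinc : P.map (Y (n * v + v) - Y (n * v)) = P.map (Y v) := by
      refine (hY.stationary_increments (n * v) v).map_eq.trans (Measure.map_congr ?_)
      filter_upwards [hY.start_zero] with ω hω
      simp [hω]
    have := hind.map_add_eq_map_conv_map (hY.measurable _) ((hY.measurable _).sub (hY.measurable _))
    rw [add_sub_cancel, hinc] at this
    rw [convPower, ih, ← this, Nat.cast_succ, add_mul, one_mul]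

/-- The root of order `n` is the law at time `u / n`. -/
theorem IsLevyProcess.isInfinitelyDivisible_map (hY : IsLevyProcess Y P) (u : ℝ≥0) :
    IsInfinitelyDivisible (P.map (Y u)) := by
  have := hY.isProbabilityMeasure
  refine ⟨Measure.isProbabilityMeasure_map (hY.measurable u).aemeasurable, fun n hn =>
    ⟨P.map (Y (u / n)), Measure.isProbabilityMeasure_map (hY.measurable _).aemeasurable, ?_⟩⟩
  rw [hY.convPower_map, mul_div_cancel₀ _ (by exact_mod_cast (by omega : n ≠ 0))]

end Levy

/-! ### Characteristic functions of Riemann sums -/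

section CharFun

variable {Ω E : Type*} [MeasurableSpace Ω] [NormedAddCommGroup E] [InnerProductSpace ℝ E]
  [MeasurableSpace E] [BorelSpace E] {P : Measure Ω}

theorem tendsto_charFun_map [IsFiniteMeasure P] {X : ℕ → Ω → E} {Z : Ω → E}
    (hX : ∀ n, AEMeasurable (X n) P) (h : ∀ᵐ ω ∂P, Tendsto (fun n => X n ω) atTop (𝓝 (Z ω)))
    (ξ : E) :
    Tendsto (fun n => charFun (P.map (X n)) ξ) atTop (𝓝 (charFun (P.map Z) ξ)) := by
  have hZ := aemeasurable_of_tendsto_metrizable_ae atTop hX h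
  have hcont : Continuous fun x : E => Complex.exp ((inner ℝ x ξ : ℝ) * Complex.I) := by fun_prop
  simp only [charFun_apply]
  rw [integral_map hZ hcont.aestronglyMeasurable]
  simp_rw [fun n => integral_map (hX n) (f := fun x : E =>
    Complex.exp ((inner ℝ x ξ : ℝ) * Complex.I)) hcont.aestronglyMeasurable]
  refine tendsto_integral_of_dominated_convergence (fun _ => 1) (fun n => ?_)
    (integrable_const _) (fun n => ae_of_all _ fun ω => ?_) ?_
  · exact (hcont.measurable.comp_aemeasurable (hX n)).aestronglyMeasurable
  · rw [Complex.norm_exp_ofReal_mul_I]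
  · filter_upwards [h] with ω hω using (hcont.tendsto _).comp hω

theorem IsLevyProcess.measurable_sum [SecondCountableTopology E] {Y : ℝ≥0 → Ω → E}
    (hY : IsLevyProcess Y P) (c : ℕ → ℝ) (v : ℝ≥0) (n : ℕ) :
    Measurable fun ω => ∑ k ∈ Finset.range n, c k • (Y ((k + 1 : ℕ) * v) ω - Y (k * v) ω) :=
  Finset.measurable_fun_sum _ fun _ _ =>
    ((hY.measurable _).sub (hY.measurable _)).const_smul _

theorem IsLevyProcess.charFun_map_sum [SecondCountableTopology E] {Y : ℝ≥0 → Ω → E} (hY : IsLevyProcess Y P) (c : ℕ → ℝ)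
    (v : ℝ≥0) (n : ℕ) (ξ : E) :
    charFun (P.map fun ω => ∑ k ∈ Finset.range n,
      c k • (Y ((k + 1 : ℕ) * v) ω - Y (k * v) ω)) ξ =
      ∏ k ∈ Finset.range n, charFun (P.map (Y v)) (c k • ξ) := by
  have hm (k : ℕ) : Measurable fun ω => Y ((k + 1 : ℕ) * v) ω - Y (k * v) ω :=
    (hY.measurable _).sub (hY.measurable _)
  have hmono : Monotone fun k : ℕ => (k : ℝ≥0) * v := fun i j hij => by
    dsimp only; gcongr
  have hind := (hY.indep_increments.nat hmono).comp (fun k x => c k • x)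
    fun k => measurable_const_smul (c k)
  have := iIndepFun.charFun_map_fun_finsetSum_eq_prod (s := Finset.range n)
    (X := fun k ω => c k • (Y ((k + 1 : ℕ) * v) ω - Y (k * v) ω))
    (fun k _ => ((hm k).const_smul _).aemeasurable)
    (hind.precomp (g := ((↑) : Finset.range n → ℕ)) Subtype.val_injective)
  rw [this, Finset.prod_apply]
  refine Finset.prod_congr rfl fun k _ => ?_
  rw [charFun_map_smul_comp (hm k).aemeasurable]
  congr 1
  have h1 := (hY.stationary_increments (k * v) v).map_eq
  rw [← add_one_mul] at h1
  push_cast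
  refine h1.trans (Measure.map_congr ?_)
  filter_upwards [hY.start_zero] with ω hω
  simp [hω]

end CharFun

/-! ### Riemann sums of the two random integrals -/

section RiemannSums

variable {Ω E : Type*} [NormedAddCommGroup E] [NormedSpace ℝ E] [CompleteSpace E]
  {Y : ℝ≥0 → Ω → E}

theorem tendsto_riemannSum_fractionalV {α t : ℝ} (hα : 0 < α) (ht : 0 < t) {ω : Ω}
    (hY : IsCadlag fun s => Y s ω) :
    Tendsto (fun n : ℕ => ∑ k ∈ Finset.range n, (t - t * ((k + 1 : ℕ) / n)) ^ α •
      (Y ((k + 1 : ℕ) * (t.toNNReal / n)) ω - Y (k * (t.toNNReal / n)) ω)) atTop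
      (𝓝 (fractionalV Y hα ht ω)) := by
  have hcast (k n : ℕ) : Real.toNNReal (t * (k / n)) = k * (t.toNNReal / n) := by
    rw [Real.toNNReal_mul ht.le, Real.toNNReal_div' (by positivity), Real.toNNReal_natCast,
      Real.toNNReal_natCast]
    ring
  have := tendsto_riemannSum_randomIntegral hY (r := Real.toNNReal) (g := fun w => t * w) ht.le
    (boundedVariationOn_rpow_sub hα ht)
    ((continuousOn_const.sub continuousOn_id).rpow_const fun _ _ => Or.inr hα.le)
    (fun x hx y _ hxy => (Real.toNNReal_lt_toNNReal_iff (hx.1.trans_lt hxy)).2 hxy)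
    continuous_real_toNNReal.continuousOn
    (fun x _ y _ hxy => mul_lt_mul_of_pos_left hxy ht) (by fun_prop) (mul_zero t) (mul_one t)
  simp only [hcast] at this
  exact this

theorem tendsto_riemannSum_rpow {α : ℝ} (hα : 0 < α) {ω : Ω} (hY : IsCadlag fun s => Y s ω) :
    Tendsto (fun n : ℕ => ∑ k ∈ Finset.range n, (((k + 1 : ℕ) / n : ℝ) ^ α) •
      (Y ((k + 1 : ℕ) * (1 / n)) ω - Y (k * (1 / n)) ω)) atTop
      (𝓝 (randomIntegral Y (fun s => Real.toNNReal (s ^ (1 / α))) (zero_le_one' ℝ)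
        boundedVariationOn_id_unit ω)) := by
  -- The nodes `(k / n)^α` are chosen so that the clock `s^(1/α)` reads `k / n`; the increments are
  -- then identically distributed.
  have hcast (k n : ℕ) : Real.toNNReal (((k / n : ℝ) ^ α) ^ (1 / α)) = k * (1 / n) := by
    rw [one_div, Real.rpow_rpow_inv (by positivity) hα.ne', Real.toNNReal_div' (by positivity),
      Real.toNNReal_natCast, Real.toNNReal_natCast]
    ring
  have hα' : 0 < 1 / α := by positivity
  have := tendsto_riemannSum_randomIntegral hY (r := fun s => Real.toNNReal (s ^ (1 / α)))
    (g := fun w => w ^ α) (zero_le_one' ℝ) boundedVariationOn_id_unit continuousOn_id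
    (fun x hx y _ hxy => (Real.toNNReal_lt_toNNReal_iff
      (Real.rpow_pos_of_pos (hx.1.trans_lt hxy) _)).2 (Real.rpow_lt_rpow hx.1 hxy hα'))
    (continuous_real_toNNReal.comp (Real.continuous_rpow_const hα'.le)).continuousOn
    (fun x hx y _ hxy => Real.rpow_lt_rpow hx.1 hxy hα)
    (Real.continuous_rpow_const hα.le).continuousOn (Real.zero_rpow hα.ne') (Real.one_rpow α)
  simp only [hcast] at this
  exact this

end RiemannSums

/-- The law of `∫_{(0,t]} (t - s)^α dY(s)` is that of `∫_{(0,1]} s dZ(s^{1/α})` whenever the Lévy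
processes `Y` and `Z` are such that `Z(v)` and `t^α Y(tv)` have the same law. -/
theorem map_randomIntegral_rpow_eq_map_fractionalV {Ω Ω' E : Type*} [MeasurableSpace Ω]
    [MeasurableSpace Ω'] [NormedAddCommGroup E] [InnerProductSpace ℝ E] [CompleteSpace E]
    [MeasurableSpace E] [BorelSpace E] [SecondCountableTopology E] {P : Measure Ω}
    {Q : Measure Ω'} {Y : ℝ≥0 → Ω → E} {Z : ℝ≥0 → Ω' → E} (hY : IsLevyProcess Y P)
    (hZ : IsLevyProcess Z Q) {α t : ℝ} (hα : 0 < α) (ht : 0 < t)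
    (hYZ : ∀ v, Q.map (Z v) = P.map fun ω => t ^ α • Y (t.toNNReal * v) ω) :
    AEMeasurable (fractionalV Y hα ht) P ∧
      HasLaw (randomIntegral Z (fun s => Real.toNNReal (s ^ (1 / α))) (zero_le_one' ℝ)
        boundedVariationOn_id_unit) (P.map (fractionalV Y hα ht)) Q := by
  have := hY.isProbabilityMeasure
  have := hZ.isProbabilityMeasure
  have hV : ∀ᵐ ω ∂P, _ := hY.cadlag.mono fun ω h => tendsto_riemannSum_fractionalV hα ht h
  have hW : ∀ᵐ ω ∂Q, _ := hZ.cadlag.mono fun ω h => tendsto_riemannSum_rpow hα h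
  have hVm (n : ℕ) := (hY.measurable_sum (fun k : ℕ => (t - t * ((k + 1 : ℕ) / n)) ^ α)
    (t.toNNReal / n) n).aemeasurable (μ := P)
  have hWm (n : ℕ) := (hZ.measurable_sum (fun k : ℕ => ((k + 1 : ℕ) / n : ℝ) ^ α)
    (1 / n) n).aemeasurable (μ := Q)
  have hVa := aemeasurable_of_tendsto_metrizable_ae atTop hVm hV
  have hWa := aemeasurable_of_tendsto_metrizable_ae atTop hWm hW
  refine ⟨hVa, hWa, ?_⟩
  have := Measure.isProbabilityMeasure_map hVa
  have := Measure.isProbabilityMeasure_map hWa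
  refine Measure.ext_of_charFun (funext fun ξ => ?_)
  have hVc := tendsto_charFun_map hVm hV ξ
  have hWc := tendsto_charFun_map hWm hW ξ
  simp only [fun n : ℕ => hY.charFun_map_sum (fun k : ℕ => (t - t * ((k + 1 : ℕ) / n)) ^ α)
    (t.toNNReal / n) n ξ] at hVc
  simp only [fun n : ℕ => hZ.charFun_map_sum (fun k : ℕ => ((k + 1 : ℕ) / n : ℝ) ^ α)
    (1 / n) n ξ] at hWc
  have hsmall : Tendsto (fun n : ℕ => charFun (P.map (Y (t.toNNReal / n))) (t ^ α • ξ)) atTop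
      (𝓝 1) := by
    have h1 : ∀ᵐ ω ∂P, Tendsto (fun n : ℕ => Y (t.toNNReal / n) ω) atTop (𝓝 (0 : E)) := by
      filter_upwards [hY.cadlag, hY.start_zero] with ω hω h0
      have := (hω 0).1.tendsto
      rw [h0] at this
      refine this.comp (tendsto_nhdsWithin_iff.2 ⟨?_, Eventually.of_forall fun n => mem_Ici.2 zero_le⟩)
      exact tendsto_const_div_atTop_nhds_zero_nat _
    have h2 := tendsto_charFun_map (fun n : ℕ => (hY.measurable (t.toNNReal / n)).aemeasurable)
      h1 (t ^ α • ξ)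
    simpa [charFun_dirac] using h2
  refine tendsto_nhds_unique hWc ?_
  -- The extra factor, tending to `1`, supplies the missing index `n`.
  have hprod := hVc.mul hsmall
  rw [mul_one] at hprod
  refine hprod.congr' ?_
  filter_upwards [eventually_gt_atTop 0] with n hn
  have hn' : (n : ℝ) ≠ 0 := by exact_mod_cast hn.ne'
  set f : ℕ → ℂ := fun j => charFun (P.map (Y (t.toNNReal / n))) ((t * (j / n)) ^ α • ξ) with hf
  have hf0 : f 0 = 1 := by
    have := Measure.isProbabilityMeasure_map (μ := P) (hY.measurable (t.toNNReal / n)).aemeasurable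
    simp [hf, Real.zero_rpow hα.ne']
  have hfn : f n = charFun (P.map (Y (t.toNNReal / n))) (t ^ α • ξ) := by
    simp [hf, div_self hn']
  have hfV : ∏ k ∈ Finset.range n, charFun (P.map (Y (t.toNNReal / n)))
      ((t - t * ((k + 1 : ℕ) / n)) ^ α • ξ) = ∏ k ∈ Finset.range n, f k := by
    -- Time reversal: the substitution `k ↦ n - 1 - k` turns `t - t(k + 1)/n` into `tk/n`.
    rw [← Finset.prod_range_reflect]
    refine Finset.prod_congr rfl fun k hk => ?_
    have hk' := Finset.mem_range.1 hk
    simp only [hf]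
    congr 3
    rw [show n - 1 - k + 1 = n - k by omega, Nat.cast_sub hk'.le]
    field_simp
    ring
  have hfW : ∏ k ∈ Finset.range n, charFun (Q.map (Z (1 / n)))
      (((k + 1 : ℕ) / n : ℝ) ^ α • ξ) = ∏ k ∈ Finset.range n, f (k + 1) := by
    refine Finset.prod_congr rfl fun k _ => ?_
    rw [hYZ, charFun_map_smul_comp (hY.measurable _).aemeasurable, smul_smul,
      ← Real.mul_rpow ht.le (by positivity), mul_one_div]
  rw [hfV, hfW, ← hfn, ← Finset.prod_range_succ, Finset.prod_range_succ', hf0, mul_one]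

theorem corollary3 (d : ℕ) (α : ℝ) (hα : 0 < α) (hα' : α < 1 / 2)
    (ν : Measure (EuclideanSpace ℝ (Fin d))) (hν : IsInfinitelyDivisible ν)
    {Ω : Type*} [MeasurableSpace Ω] (P : Measure Ω)
    (Y : ℝ≥0 → Ω → EuclideanSpace ℝ (Fin d)) (hY : IsLevyProcess Y P)
    (hYν : HasLaw (Y 1) ν P) (t : ℝ) (ht : 0 < t) :
    2 < 1 / α ∧
      ∃ μ ∈ GenSSelfdecomposable (EuclideanSpace ℝ (Fin d)) (1 / α),
        HasLaw (fractionalV Y hα ht) μ P := by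
  refine ⟨by rw [lt_div_iff₀ hα]; linarith, P.map (fractionalV Y hα ht), ?_⟩
  -- `IsJurekImage` asks for a sample space in `Type`, whereas `Ω` may live in any universe; the
  -- path space qualifies.
  obtain ⟨Φ, hΦ, hYΦ, hX⟩ := hY.exists_map_path
  have hZ := hX.smul_comp_mul (t ^ α) (Real.toNNReal_pos.2 ht)
  have key := map_randomIntegral_rpow_eq_map_fractionalV hY hZ hα ht fun v => by
    rw [Measure.map_map (hZ.measurable v) hΦ]
    refine Measure.map_congr ?_
    filter_upwards [hYΦ] with ω hω
    simp [hω]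
  exact ⟨⟨_, hZ.isInfinitelyDivisible_map 1, _, _, _, _, hZ,
    ⟨(hZ.measurable 1).aemeasurable, rfl⟩, key.2⟩, key.1, rfl⟩
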